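/- Let $n\ge 1$ be an integer and $\Sigma=\{0,1\}$. For $\mathbf{x}=x_1\cdots x_n\in\Sigma^n$ let $\mathcal{B}(\mathbf{x})\subseteq\Sigma^{n-1}$ be the single-deletion single-substitution ball of $\mathbf{x}$, i.e. the set of all sequences obtained from $\mathbf{x}$ by deleting exactly one symbol and then changing at most one symbol. A set $\mathcal{C}\subseteq\Sigma^n$ is an $(n,N;\mathcal{B})$-reconstruction code if $|\mathcal{B}(\mathbf{x})\cap\mathcal{B}(\mathbf{y})|<N$ for any two distinct $\mathbf{x},\mathbf{y}\in\mathcal{C}$; the redundancy of a nonempty $\mathcal{C}$ is $\mathrm{red}(\mathcal{C})=n-\log_2|\mathcal{C}|$. Put $\mathrm{VT}^0(\mathbf{x})=\sum_{i=1}^n x_i$ and $\mathrm{VT}^1(\mathbf{x})=\sum_{i=1}^n i\,x_i$. For integers $s_0\in\{0,1,2,3\}$ and $s_1\in\{0,1,\ldots,2n-1\}$ let \[ \mathcal{C}_1=\mathcal{C}_1(s_0,s_1)=\{\mathbf{x}\in\Sigma^n:\ \mathrm{VT}^0(\mathbf{x})\equiv s_0 \pmod 4,\ \mathrm{VT}^1(\mathbf{x})\equiv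 s_1 \pmod{2n}\}. \] Then, for every such $s_0,s_1$, $\mathcal{C}_1(s_0,s_1)$ is an $(n,14;\mathcal{B})$-reconstruction code, i.e. $|\mathcal{B}(\mathbf{x})\cap\mathcal{B}(\mathbf{y})|\le 13$ for any two distinct $\mathbf{x},\mathbf{y}\in\mathcal{C}_1(s_0,s_1)$. Moreover, there exist $s_0\in\{0,1,2,3\}$ and $s_1\in\{0,1,\ldots,2n-1\}$ such that $\mathcal{C}_1(s_0,s_1)$ is nonempty and $\mathrm{red}(\mathcal{C}_1(s_0,s_1))\le\log_2 n+3$. -/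

import Mathlib

namespace DelSub

/-- Binary sequences of length `n`. The entry written `x_i` with `1 ≤ i ≤ n` is `x ⟨i - 1, _⟩`. -/
abbrev BinSeq (n : ℕ) : Type := Fin n → Fin 2

/-- The single-deletion ball: all subsequences of `x` of length `n - 1`. -/
def deletionBall {n : ℕ} (x : BinSeq n) : Set (BinSeq (n - 1)) :=
  {y | ∃ f : Fin (n - 1) → Fin n, StrictMono f ∧ y = x ∘ f}

/-- The single-substitution ball: all sequences at Hamming distance at most one from `x`. -/
def substitutionBall {n : ℕ} (x : BinSeq n) : Set (BinSeq n) :=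
  {y | hammingDist x y ≤ 1}

/-- The single-deletion single-substitution ball: all sequences obtainable from `x` by
one deletion and (at most) one substitution. -/
def delSubBall {n : ℕ} (x : BinSeq n) : Set (BinSeq (n - 1)) :=
  {z | ∃ y ∈ deletionBall x, z ∈ substitutionBall y}

/-- `C` is an `(n, N; B)`-reconstruction code, `B` being the single-deletion
single-substitution ball. -/
def IsReconstructionCode {n : ℕ} (N : ℕ) (C : Set (BinSeq n)) : Prop :=
  ∀ x ∈ C, ∀ y ∈ C, x ≠ y → (delSubBall x ∩ delSubBall y).ncard < N

/-- The redundancy `n - log₂ |C|` of a (nonempty) code. -/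
noncomputable def redundancy {n : ℕ} (C : Set (BinSeq n)) : ℝ :=
  (n : ℝ) - Real.logb 2 (C.ncard : ℝ)

/-- The weight: the number of ones. -/
def weight {n : ℕ} (x : BinSeq n) : ℕ := ∑ i : Fin n, (x i : ℕ)

/-- The `k`-th order VT syndrome: the weight for `k = 0`, and
`∑_{i=1}^n ∑_{j=1}^i j^(k-1) x_i` for `k ≥ 1`. -/
def vtSyndrome {n : ℕ} : ℕ → BinSeq n → ℕ
  | 0, x => weight x
  | k + 1, x => ∑ i : Fin n, ∑ j ∈ Finset.Icc 1 ((i : ℕ) + 1), j ^ k * (x i : ℕ)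

/-- The code of all sequences of length `n` with zeroth order VT syndrome congruent to `s₀`
modulo `4` and first order VT syndrome congruent to `s₁` modulo `2n`. -/
def codeC1 (n s₀ s₁ : ℕ) : Set (BinSeq n) :=
  {x | vtSyndrome 0 x ≡ s₀ [MOD 4] ∧ vtSyndrome 1 x ≡ s₁ [MOD 2 * n]}

end DelSub

namespace DelSub

/-- Delete the entry at position `i` of an infinite binary sequence. -/
def del (i : ℕ) (X : ℕ → Bool) : ℕ → Bool := fun m => if m < i then X m else X (m + 1)

/-- Flip the entry at position `t`. -/
def flipAt (Z : ℕ → Bool) (t : ℕ) : ℕ → Bool := fun m => if m = t then !(Z m) else Z m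

/-- The two sequences differ in at most one position. -/
def Near (Z W : ℕ → Bool) : Prop := ∃ t, ∀ m, m ≠ t → Z m = W m

/-- Common neighbours of `X` and `Y` where the deletion in `X` is not to the right of the one
in `Y`. -/
def shiftSet (X Y : ℕ → Bool) : Set (ℕ → Bool) :=
  {Z | ∃ i j, i ≤ j ∧ Near Z (del i X) ∧ Near Z (del j Y)}

/-- `p₁ < p₂ < p₃` are the first three and `q₃ < q₂ < q₁` the last three positions where `X` and
`Y` differ, and there are at least four such positions. -/
structure Window (X Y : ℕ → Bool) (p₁ p₂ p₃ q₃ q₂ q₁ : ℕ) : Prop where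
  p12 : p₁ < p₂
  p23 : p₂ < p₃
  q32 : q₃ < q₂
  q21 : q₂ < q₁
  pq : p₂ ≤ q₃
  qp : p₃ ≤ q₂
  ne_p1 : X p₁ ≠ Y p₁
  ne_p2 : X p₂ ≠ Y p₂
  ne_p3 : X p₃ ≠ Y p₃
  ne_q1 : X q₁ ≠ Y q₁
  ne_q2 : X q₂ ≠ Y q₂
  ne_q3 : X q₃ ≠ Y q₃
  eq_lt : ∀ m, m < p₁ → X m = Y m
  eq_p12 : ∀ m, p₁ < m → m < p₂ → X m = Y m
  eq_p23 : ∀ m, p₂ < m → m < p₃ → X m = Y m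
  eq_q32 : ∀ m, q₃ < m → m < q₂ → X m = Y m
  eq_q21 : ∀ m, q₂ < m → m < q₁ → X m = Y m
  eq_gt : ∀ m, q₁ < m → X m = Y m

theorem Window.swap {X Y : ℕ → Bool} {p₁ p₂ p₃ q₃ q₂ q₁ : ℕ} (h : Window X Y p₁ p₂ p₃ q₃ q₂ q₁) :
    Window Y X p₁ p₂ p₃ q₃ q₂ q₁ where
  p12 := h.p12
  p23 := h.p23
  q32 := h.q32
  q21 := h.q21
  pq := h.pq
  qp := h.qp
  ne_p1 := h.ne_p1.symm
  ne_p2 := h.ne_p2.symm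
  ne_p3 := h.ne_p3.symm
  ne_q1 := h.ne_q1.symm
  ne_q2 := h.ne_q2.symm
  ne_q3 := h.ne_q3.symm
  eq_lt m a := (h.eq_lt m a).symm
  eq_p12 m a b := (h.eq_p12 m a b).symm
  eq_p23 m a b := (h.eq_p23 m a b).symm
  eq_q32 m a b := (h.eq_q32 m a b).symm
  eq_q21 m a b := (h.eq_q21 m a b).symm
  eq_gt m a := (h.eq_gt m a).symm

theorem eq_flipAt {Z W : ℕ → Bool} {a : ℕ} (h : ∀ m, m ≠ a → Z m = W m) (ha : Z a ≠ W a) :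
    Z = flipAt W a := by
  funext m
  by_cases hm : m = a
  · subst hm
    simpa [flipAt, Bool.eq_not] using ha
  · simpa [flipAt, hm] using h m hm

theorem bool_eq_of_ne {a b c : Bool} (h₁ : a ≠ b) (h₂ : c ≠ b) : a = c := by
  revert a b c; decide

theorem Near.of_two {Z W₁ W₂ : ℕ → Bool} {a b : ℕ} (h₁ : Near Z W₁) (h₂ : Near Z W₂)
    (hab : a ≠ b) (ha : W₁ a ≠ W₂ a) (hb : W₁ b ≠ W₂ b) :
    (∀ m, m ≠ a → m ≠ b → W₁ m = W₂ m) ∧ (Z = flipAt W₂ a ∨ Z = flipAt W₂ b) ∧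
      (Z = flipAt W₁ a ∨ Z = flipAt W₁ b) := by
  obtain ⟨s, hs⟩ := h₁
  obtain ⟨t, ht⟩ := h₂
  have key : (s = a ∧ t = b) ∨ (s = b ∧ t = a) := by grind
  refine ⟨by grind, ?_⟩
  rcases key with ⟨rfl, rfl⟩ | ⟨rfl, rfl⟩
  · exact ⟨Or.inr (eq_flipAt ht (by grind)), Or.inl (eq_flipAt hs (by grind))⟩
  · exact ⟨Or.inl (eq_flipAt ht (by grind)), Or.inr (eq_flipAt hs (by grind))⟩

theorem Near.of_one {Z W₁ W₂ : ℕ → Bool} {a : ℕ} (h₁ : Near Z W₁) (h₂ : Near Z W₂)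
    (ha : W₁ a ≠ W₂ a) (h : ∀ m, m ≠ a → W₁ m = W₂ m) : Z = W₁ ∨ Z = W₂ := by
  obtain ⟨s, hs⟩ := h₁
  obtain ⟨t, ht⟩ := h₂
  by_cases hz : Z a = W₁ a
  · left; funext m; grind
  · have := bool_eq_of_ne hz (Ne.symm ha)
    right; funext m; grind

theorem del_eq_del_of_const {X : ℕ → Bool} {i j : ℕ} (hij : i ≤ j)
    (h : ∀ m, i ≤ m → m < j → X m = X (m + 1)) : del i X = del j X := by
  funext m; simp only [del]; grind

/-- The middle part of `del i X` and `del j Y` compares `X (m + 1)` with `Y m`. -/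
theorem del_mid {X Y : ℕ → Bool} {i j m : ℕ} (h₁ : i ≤ m) (h₂ : m < j) :
    del i X m = X (m + 1) ∧ del j Y m = Y m := by
  simp only [del]; grind

theorem del_eq_iff {X Y : ℕ → Bool} {i j m : ℕ} (h₁ : i ≤ m) (h₂ : m < j) :
    del i X m = del j Y m ↔ X (m + 1) = Y m := by
  rw [(del_mid (Y := Y) h₁ h₂).1, (del_mid (X := X) h₁ h₂).2]

theorem del_left {X Y : ℕ → Bool} {i j m : ℕ} (hij : i ≤ j) (h₁ : m < i) :
    del i X m = X m ∧ del j Y m = Y m := by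
  simp only [del]; grind

theorem del_right {X Y : ℕ → Bool} {i j m : ℕ} (hij : i ≤ j) (h₁ : j < m) :
    del i X (m - 1) = X m ∧ del j Y (m - 1) = Y m := by
  simp only [del]; grind

section

variable {X Y Z : ℕ → Bool} {p₁ p₂ p₃ q₃ q₂ q₁ : ℕ}

theorem shiftSet_cases (w : Window X Y p₁ p₂ p₃ q₃ q₂ q₁)
    (hA : ∃ τ, p₂ ≤ τ ∧ τ < q₂ ∧ X (τ + 1) ≠ Y τ) (hZ : Z ∈ shiftSet X Y) :
    (∃ i j, i ≤ p₁ ∧ q₁ ≤ j ∧ Near Z (del i X) ∧ Near Z (del j Y)) ∨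
    (∃ τ, p₂ ≤ τ ∧ τ < q₂ ∧ X (τ + 1) ≠ Y τ ∧
      (∀ m, p₂ ≤ m → m < q₁ → m ≠ τ → X (m + 1) = Y m) ∧
      (Z = flipAt (del q₁ Y) p₁ ∨ Z = flipAt (del q₁ Y) τ)) ∨
    ((∀ m, p₃ ≤ m → m < q₁ → X (m + 1) = Y m) ∧
      (Z = flipAt (del q₁ Y) p₁ ∨ Z = flipAt (del q₁ Y) p₂)) ∨
    (∃ τ, p₂ ≤ τ ∧ τ < q₂ ∧ X (τ + 1) ≠ Y τ ∧
      (∀ m, p₁ ≤ m → m < q₂ → m ≠ τ → X (m + 1) = Y m) ∧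
      (Z = flipAt (del p₁ X) (q₁ - 1) ∨ Z = flipAt (del p₁ X) τ)) ∨
    ((∀ m, p₁ ≤ m → m < q₃ → X (m + 1) = Y m) ∧
      (Z = flipAt (del p₁ X) (q₁ - 1) ∨ Z = flipAt (del p₁ X) (q₂ - 1))) := by
  obtain ⟨i, j, hij, h₁, h₂⟩ := hZ
  obtain ⟨τ, hτ₁, hτ₂, hτ⟩ := hA
  obtain ⟨p12, p23, q32, q21, pq, qp, n1, n2, n3, m1, m2, m3, e0, e12, e23, f32, f21, f0⟩ := w
  have L : ∀ m, m < i → X m ≠ Y m → del i X m ≠ del j Y m := fun m hm h => by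
    rw [(del_left (Y := Y) hij hm).1, (del_left (X := X) hij hm).2]; exact h
  have R : ∀ m, j < m → X m ≠ Y m → del i X (m - 1) ≠ del j Y (m - 1) := fun m hm h => by
    rw [(del_right (Y := Y) hij hm).1, (del_right (X := X) hij hm).2]; exact h
  have C : ∀ m, i ≤ m → m < j → (del i X m = del j Y m ↔ X (m + 1) = Y m) := fun _ => del_eq_iff
  by_cases hi1 : i ≤ p₁
  · by_cases hj1 : q₁ ≤ j
    · exact Or.inl ⟨i, j, hi1, hj1, h₁, h₂⟩
    have b1 := R q₁ (by omega) m1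
    by_cases hj2 : q₂ ≤ j
    · right; right; right; left
      have b2 : del i X τ ≠ del j Y τ := fun h => hτ ((C τ (by omega) (by omega)).1 h)
      obtain ⟨ag, -, hz⟩ := Near.of_two h₁ h₂ (by omega) b1 b2
      have ag' : ∀ m, i ≤ m → m < q₂ → m ≠ τ → X (m + 1) = Y m := fun m a b c =>
        (C m a (by omega)).1 (ag m (by omega) c)
      have hd : del i X = del p₁ X := del_eq_del_of_const hi1 fun m a b => by
        rw [ag' m a (by omega) (by omega), e0 m b]
      rw [hd] at hz
      exact ⟨τ, hτ₁, hτ₂, hτ, fun m a b c => ag' m (by omega) b c, hz⟩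
    · right; right; right; right
      have b2 := R q₂ (by omega) m2
      obtain ⟨ag, -, hz⟩ := Near.of_two h₁ h₂ (by omega) b1 b2
      have hj3 : q₃ ≤ j := by
        by_contra hlt
        exact R q₃ (by omega) m3 (ag _ (by omega) (by omega))
      have ag' : ∀ m, i ≤ m → m < q₃ → X (m + 1) = Y m := fun m a b =>
        (C m a (by omega)).1 (ag m (by omega) (by omega))
      have hd : del i X = del p₁ X := del_eq_del_of_const hi1 fun m a b => by
        rw [ag' m a (by omega), e0 m b]
      rw [hd] at hz
      exact ⟨fun m a b => ag' m (by omega) b, hz⟩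
  have a1 := L p₁ (by omega) n1
  by_cases hj1 : q₁ ≤ j
  · by_cases hi2 : i ≤ p₂
    · right; left
      have b2 : del i X τ ≠ del j Y τ := fun h => hτ ((C τ (by omega) (by omega)).1 h)
      obtain ⟨ag, hz, -⟩ := Near.of_two h₁ h₂ (by omega) a1 b2
      have ag' : ∀ m, p₂ ≤ m → m < j → m ≠ τ → X (m + 1) = Y m := fun m a b c =>
        (C m (by omega) b).1 (ag m (by omega) c)
      have hd : del q₁ Y = del j Y := del_eq_del_of_const hj1 fun m a b => by
        rw [← ag' m (by omega) b (by omega), f0 (m + 1) (by omega)]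
      rw [hd]
      exact ⟨τ, hτ₁, hτ₂, hτ, fun m a b c => ag' m a (by omega) c, hz⟩
    · right; right; left
      have b2 := L p₂ (by omega) n2
      obtain ⟨ag, hz, -⟩ := Near.of_two h₁ h₂ (by omega) a1 b2
      have hi3 : i ≤ p₃ := by
        by_contra hlt
        exact L p₃ (by omega) n3 (ag _ (by omega) (by omega))
      have ag' : ∀ m, p₃ ≤ m → m < j → X (m + 1) = Y m := fun m a b =>
        (C m (by omega) b).1 (ag m (by omega) (by omega))
      have hd : del q₁ Y = del j Y := del_eq_del_of_const hj1 fun m a b => by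
        rw [← ag' m (by omega) b, f0 (m + 1) (by omega)]
      rw [hd]
      exact ⟨fun m a b => ag' m a (by omega), hz⟩
  exfalso
  have b1 := R q₁ (by omega) m1
  obtain ⟨ag, -, -⟩ := Near.of_two h₁ h₂ (by omega) a1 b1
  have hi2 : i ≤ p₂ := by
    by_contra hlt
    exact L p₂ (by omega) n2 (ag _ (by omega) (by omega))
  have hj2 : q₂ ≤ j := by
    by_contra hlt
    exact R q₂ (by omega) m2 (ag _ (by omega) (by omega))
  exact hτ ((C τ (by omega) (by omega)).1 (ag τ (by omega) (by omega)))

end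
section

variable {X Y Z : ℕ → Bool} {p₁ p₂ p₃ q₃ q₂ q₁ : ℕ}

theorem Window.del_eq_outside (w : Window X Y p₁ p₂ p₃ q₃ q₂ q₁) {m : ℕ} (h : m < p₁ ∨ q₁ ≤ m) :
    del p₁ X m = del q₁ Y m := by
  have := w.p12; have := w.p23; have := w.qp; have := w.q21
  have := w.eq_lt m; have := w.eq_gt (m + 1)
  simp only [del]; grind

theorem Window.del_eq_flipAt_of_unique (w : Window X Y p₁ p₂ p₃ q₃ q₂ q₁) {τ : ℕ} (h₁ : p₁ ≤ τ)
    (h₂ : τ < q₁) (hτ : X (τ + 1) ≠ Y τ)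
    (hu : ∀ m, p₁ ≤ m → m < q₁ → m ≠ τ → X (m + 1) = Y m) :
    del p₁ X = flipAt (del q₁ Y) τ ∧ del q₁ Y = flipAt (del p₁ X) τ := by
  have h : ∀ m, m ≠ τ → del p₁ X m = del q₁ Y m := fun m hm => by
    by_cases hm' : m < p₁ ∨ q₁ ≤ m
    · exact w.del_eq_outside hm'
    · exact (del_eq_iff (by omega) (by omega)).2 (hu m (by omega) (by omega) hm)
  have h' : del p₁ X τ ≠ del q₁ Y τ := fun e => hτ ((del_eq_iff h₁ h₂).1 e)
  exact ⟨eq_flipAt h h', eq_flipAt (fun m hm => (h m hm).symm) h'.symm⟩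

theorem exists_eq_of_unique {α : Type*} [Inhabited α] {P : α → Prop}
    (h : ∀ a b, P a → P b → a = b) : ∃ c, ∀ a, P a → a = c := by
  by_cases hP : ∃ a, P a
  · obtain ⟨c, hc⟩ := hP
    exact ⟨c, fun a ha => h a c ha hc⟩
  · exact ⟨default, fun a ha => (hP ⟨a, ha⟩).elim⟩

/-- The common neighbours when the shifted comparison has a single mismatch in the window. -/
theorem shiftSet_of_one (w : Window X Y p₁ p₂ p₃ q₃ q₂ q₁)
    (hA : ∃ τ, p₂ ≤ τ ∧ τ < q₂ ∧ X (τ + 1) ≠ Y τ) {τ : ℕ} (hτ₁ : p₁ ≤ τ) (hτ₂ : τ < q₁)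
    (hτ : X (τ + 1) ≠ Y τ) (hu : ∀ m, p₁ ≤ m → m < q₁ → m ≠ τ → X (m + 1) = Y m) :
    ∃ t₀ s₀, ∀ Z ∈ shiftSet X Y, Z = del q₁ Y ∨ Z = del p₁ X ∨ Z = flipAt (del q₁ Y) t₀ ∨
      Z = flipAt (del p₁ X) s₀ ∨ Z = flipAt (del q₁ Y) p₁ ∨ Z = flipAt (del p₁ X) (q₁ - 1) ∨
      ((∀ m, p₃ ≤ m → m < q₁ → X (m + 1) = Y m) ∧ Z = flipAt (del q₁ Y) p₂) ∨
      ((∀ m, p₁ ≤ m → m < q₃ → X (m + 1) = Y m) ∧ Z = flipAt (del p₁ X) (q₂ - 1)) := by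
  obtain ⟨t₀, ht₀⟩ := exists_eq_of_unique
    (P := fun σ => σ < p₁ ∧ X (σ + 1) ≠ X σ ∧ ∀ k, σ < k → k < p₁ → X (k + 1) = X k) (by
      rintro a b ⟨a1, a2, a3⟩ ⟨b1, b2, b3⟩
      rcases lt_trichotomy a b with h | h | h
      · exact absurd (a3 b h b1) b2
      · exact h
      · exact absurd (b3 a h a1) a2)
  obtain ⟨s₀, hs₀⟩ := exists_eq_of_unique
    (P := fun σ => q₁ ≤ σ ∧ Y (σ + 1) ≠ Y σ ∧ ∀ k, q₁ ≤ k → k < σ → Y (k + 1) = Y k) (by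
      rintro a b ⟨a1, a2, a3⟩ ⟨b1, b2, b3⟩
      rcases lt_trichotomy a b with h | h | h
      · exact absurd (b3 a a1 h) a2
      · exact h
      · exact absurd (a3 b b1 h) b2)
  obtain ⟨hUV, hVU⟩ := w.del_eq_flipAt_of_unique hτ₁ hτ₂ hτ hu
  have hpq : p₁ < q₁ := by have := w.p12; have := w.p23; have := w.qp; have := w.q21; omega
  refine ⟨t₀, s₀, fun Z hZ => ?_⟩
  rcases shiftSet_cases w hA hZ with ⟨i, j, hi, hj, h₁, h₂⟩ | ⟨σ, a1, a2, a3, -, hz⟩ | ⟨hF, hz⟩ |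
    ⟨σ, a1, a2, a3, -, hz⟩ | ⟨hF, hz⟩
  · have C : ∀ m, i ≤ m → m < j → (del i X m = del j Y m ↔ X (m + 1) = Y m) := fun _ => del_eq_iff
    have bτ : del i X τ ≠ del j Y τ := fun h => hτ ((C τ (by omega) (by omega)).1 h)
    by_cases hl : ∃ σ, i ≤ σ ∧ σ < p₁ ∧ X (σ + 1) ≠ X σ
    · obtain ⟨σ, l1, l2, l3⟩ := hl
      have bσ : del i X σ ≠ del j Y σ := fun h => l3 (by
        rw [(C σ (by omega) (by omega)).1 h, w.eq_lt σ l2])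
      obtain ⟨ag, hz, -⟩ := Near.of_two h₁ h₂ (by omega) bτ bσ
      have ag' : ∀ m, i ≤ m → m < j → m ≠ τ → m ≠ σ → X (m + 1) = Y m := fun m a b c d =>
        (C m a b).1 (ag m c d)
      have hd : del q₁ Y = del j Y := del_eq_del_of_const hj fun m a b => by
        rw [← ag' m (by omega) b (by omega) (by omega), w.eq_gt (m + 1) (by omega)]
      have hσ : σ = t₀ := ht₀ σ ⟨l2, l3, fun k a b => by
        rw [ag' k (by omega) (by omega) (by omega) (by omega), w.eq_lt k b]⟩
      rw [← hd, ← hUV, hσ] at hz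
      tauto
    by_cases hr : ∃ σ, q₁ ≤ σ ∧ σ < j ∧ Y (σ + 1) ≠ Y σ
    · obtain ⟨σ, l1, l2, l3⟩ := hr
      have bσ : del i X σ ≠ del j Y σ := fun h => l3 (by
        rw [← (C σ (by omega) (by omega)).1 h, w.eq_gt (σ + 1) (by omega)])
      obtain ⟨ag, -, hz⟩ := Near.of_two h₁ h₂ (by omega) bτ bσ
      have ag' : ∀ m, i ≤ m → m < j → m ≠ τ → m ≠ σ → X (m + 1) = Y m := fun m a b c d =>
        (C m a b).1 (ag m c d)
      have hd : del i X = del p₁ X := del_eq_del_of_const hi fun m a b => by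
        rw [ag' m (by omega) (by omega) (by omega) (by omega), w.eq_lt m (by omega)]
      have hσ : σ = s₀ := hs₀ σ ⟨l1, l3, fun k a b => by
        rw [← ag' k (by omega) (by omega) (by omega) (by omega), w.eq_gt (k + 1) (by omega)]⟩
      rw [hd, ← hVU, hσ] at hz
      tauto
    push Not at hl hr
    rw [del_eq_del_of_const hi fun m a b => (hl m a b).symm] at h₁
    rw [← del_eq_del_of_const hj fun m a b => (hr m a b).symm] at h₂
    have : Z = del p₁ X ∨ Z = del q₁ Y := Near.of_one h₁ h₂
      (fun e => hτ ((del_eq_iff hτ₁ hτ₂).1 e)) fun m hm => by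
        rw [hUV]; simp [flipAt, hm]
    tauto
  · have : σ = τ := by
      by_contra h
      exact a3 (hu σ (by have := w.p12; omega) (by have := w.q21; omega) h)
    rw [this, ← hUV] at hz
    tauto
  · tauto
  · have : σ = τ := by
      by_contra h
      exact a3 (hu σ (by have := w.p12; omega) (by have := w.q21; omega) h)
    rw [this, ← hVU] at hz
    tauto
  · tauto

/-- The common neighbours when the shifted comparison has two mismatches in the window. -/
theorem shiftSet_of_two (w : Window X Y p₁ p₂ p₃ q₃ q₂ q₁)
    (hA : ∃ τ, p₂ ≤ τ ∧ τ < q₂ ∧ X (τ + 1) ≠ Y τ) {a b : ℕ} (hab : a ≠ b)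
    (ha₁ : p₁ ≤ a) (ha₂ : a < q₁) (hb₁ : p₁ ≤ b) (hb₂ : b < q₁)
    (ha : X (a + 1) ≠ Y a) (hb : X (b + 1) ≠ Y b)
    (hu : ∀ m, p₁ ≤ m → m < q₁ → m ≠ a → m ≠ b → X (m + 1) = Y m) :
    ∀ Z ∈ shiftSet X Y, Z = flipAt (del q₁ Y) a ∨ Z = flipAt (del q₁ Y) b ∨
      Z = flipAt (del q₁ Y) p₁ ∨ Z = flipAt (del q₁ Y) p₂ ∨
      Z = flipAt (del p₁ X) (q₁ - 1) ∨ Z = flipAt (del p₁ X) (q₂ - 1) := by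
  have hpq : p₁ < q₁ := by have := w.p12; have := w.p23; have := w.qp; have := w.q21; omega
  have hUV : flipAt (del p₁ X) a = flipAt (del q₁ Y) b ∧
      flipAt (del p₁ X) b = flipAt (del q₁ Y) a := by
    have h : ∀ m, m ≠ a → m ≠ b → del p₁ X m = del q₁ Y m := fun m hm hm₂ => by
      by_cases hm' : m < p₁ ∨ q₁ ≤ m
      · exact w.del_eq_outside hm'
      · exact (del_eq_iff (by omega) (by omega)).2 (hu m (by omega) (by omega) hm hm₂)
    have ha' : del p₁ X a ≠ del q₁ Y a := fun e => ha ((del_eq_iff ha₁ ha₂).1 e)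
    have hb' : del p₁ X b ≠ del q₁ Y b := fun e => hb ((del_eq_iff hb₁ hb₂).1 e)
    constructor
    · refine eq_flipAt (fun m hm => ?_) (by simpa [flipAt, hab.symm] using hb')
      by_cases hma : m = a
      · subst hma; simpa [flipAt, Bool.eq_not] using ha'
      · simpa [flipAt, hma] using h m hma hm
    · refine eq_flipAt (fun m hm => ?_) (by simpa [flipAt, hab] using ha')
      by_cases hma : m = b
      · subst hma; simpa [flipAt, Bool.eq_not] using hb'
      · simpa [flipAt, hma] using h m hm hma
  intro Z hZ
  rcases shiftSet_cases w hA hZ with ⟨i, j, hi, hj, h₁, h₂⟩ | ⟨σ, a1, a2, a3, -, hz⟩ | ⟨hF, hz⟩ |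
    ⟨σ, a1, a2, a3, -, hz⟩ | ⟨hF, hz⟩
  · have C : ∀ m, i ≤ m → m < j → (del i X m = del j Y m ↔ X (m + 1) = Y m) := fun _ => del_eq_iff
    obtain ⟨ag, hz, -⟩ := Near.of_two h₁ h₂ hab
      (fun h => ha ((C a (by omega) (by omega)).1 h))
      (fun h => hb ((C b (by omega) (by omega)).1 h))
    have hd : del q₁ Y = del j Y := del_eq_del_of_const hj fun m k₁ k₂ => by
      rw [← (C m (by omega) k₂).1 (ag m (by omega) (by omega)), w.eq_gt (m + 1) (by omega)]
    rw [← hd] at hz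
    tauto
  · have : σ = a ∨ σ = b := by
      by_contra! h
      exact a3 (hu σ (by have := w.p12; omega) (by have := w.q21; omega) h.1 h.2)
    rcases this with rfl | rfl <;> tauto
  · tauto
  · have : σ = a ∨ σ = b := by
      by_contra! h
      exact a3 (hu σ (by have := w.p12; omega) (by have := w.q21; omega) h.1 h.2)
    rcases this with rfl | rfl
    · rw [hUV.1] at hz; tauto
    · rw [hUV.2] at hz; tauto
  · tauto

/-- The common neighbours when the shifted comparison has at least three mismatches in the
window. -/
theorem shiftSet_of_three (w : Window X Y p₁ p₂ p₃ q₃ q₂ q₁)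
    (hA : ∃ τ, p₂ ≤ τ ∧ τ < q₂ ∧ X (τ + 1) ≠ Y τ) {a b c : ℕ} (hab : a ≠ b) (hac : a ≠ c)
    (hbc : b ≠ c) (ha₁ : p₁ ≤ a) (ha₂ : a < q₁) (hb₁ : p₁ ≤ b) (hb₂ : b < q₁)
    (hc₁ : p₁ ≤ c) (hc₂ : c < q₁)
    (ha : X (a + 1) ≠ Y a) (hb : X (b + 1) ≠ Y b) (hc : X (c + 1) ≠ Y c) :
    ∃ W, ∀ Z ∈ shiftSet X Y, Z = W ∨
      Z = flipAt (del q₁ Y) p₁ ∨ Z = flipAt (del q₁ Y) p₂ ∨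
      Z = flipAt (del p₁ X) (q₁ - 1) ∨ Z = flipAt (del p₁ X) (q₂ - 1) := by
  have k1 := w.p12
  have k2 := w.q21
  have excl : ∀ τ σ, p₂ ≤ τ → τ < q₂ → p₂ ≤ σ → σ < q₂ → X (τ + 1) ≠ Y τ →
      (∀ m, p₂ ≤ m → m < q₁ → m ≠ τ → X (m + 1) = Y m) →
      (∀ m, p₁ ≤ m → m < q₂ → m ≠ σ → X (m + 1) = Y m) → False := by
    intro τ σ h1 h2 h3 h4 h0 hu hv
    have hστ : τ = σ := by
      by_contra h
      exact h0 (hv τ (by omega) h2 h)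
    subst hστ
    have : ∀ m, p₁ ≤ m → m < q₁ → m ≠ τ → X (m + 1) = Y m := fun m l1 l2 l3 => by
      by_cases hm : p₂ ≤ m
      · exact hu m hm l2 l3
      · exact hv m l1 (by omega) l3
    have ea : a = τ := by by_contra h; exact ha (this a ha₁ ha₂ h)
    have eb : b = τ := by by_contra h; exact hb (this b hb₁ hb₂ h)
    omega
  have zero : ∀ Z, (∃ i j, i ≤ p₁ ∧ q₁ ≤ j ∧ Near Z (del i X) ∧ Near Z (del j Y)) → False := by
    rintro Z ⟨i, j, hi, hj, h₁, h₂⟩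
    have C : ∀ m, i ≤ m → m < j → (del i X m = del j Y m ↔ X (m + 1) = Y m) := fun _ => del_eq_iff
    obtain ⟨ag, -, -⟩ := Near.of_two h₁ h₂ hab
      (fun h => ha ((C a (by omega) (by omega)).1 h))
      (fun h => hb ((C b (by omega) (by omega)).1 h))
    exact hc ((C c (by omega) (by omega)).1 (ag c hac.symm hbc.symm))
  by_cases hF : ∃ τ, p₂ ≤ τ ∧ τ < q₂ ∧ X (τ + 1) ≠ Y τ ∧
      (∀ m, p₂ ≤ m → m < q₁ → m ≠ τ → X (m + 1) = Y m)
  · obtain ⟨τ, t1, t2, t3, t4⟩ := hF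
    refine ⟨flipAt (del q₁ Y) τ, fun Z hZ => ?_⟩
    rcases shiftSet_cases w hA hZ with h | ⟨σ, a1, a2, a3, a4, hz⟩ | ⟨-, hz⟩ |
      ⟨σ, a1, a2, a3, a4, hz⟩ | ⟨-, hz⟩
    · exact (zero Z h).elim
    · have : σ = τ := by
        by_contra h
        exact a3 (t4 σ a1 (by omega) h)
      rw [this] at hz
      tauto
    · tauto
    · exact (excl τ σ t1 t2 a1 a2 t3 t4 a4).elim
    · tauto
  · obtain ⟨τ, hτ⟩ := exists_eq_of_unique (P := fun τ => p₂ ≤ τ ∧ τ < q₂ ∧ X (τ + 1) ≠ Y τ ∧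
      (∀ m, p₁ ≤ m → m < q₂ → m ≠ τ → X (m + 1) = Y m)) (by
        rintro a b ⟨a1, a2, a3, a4⟩ ⟨b1, b2, b3, b4⟩
        by_contra h
        exact a3 (b4 a (by omega) (by omega) h))
    refine ⟨flipAt (del p₁ X) τ, fun Z hZ => ?_⟩
    rcases shiftSet_cases w hA hZ with h | ⟨σ, a1, a2, a3, a4, hz⟩ | ⟨-, hz⟩ |
      ⟨σ, a1, a2, a3, a4, hz⟩ | ⟨-, hz⟩
    · exact (zero Z h).elim
    · exact (hF ⟨σ, a1, a2, a3, a4⟩).elim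
    · tauto
    · rw [hτ σ ⟨a1, a2, a3, a4⟩] at hz
      tauto
    · tauto

end

/-- The entrywise difference of two binary sequences. -/
def diff (X Y : ℕ → Bool) (k : ℕ) : ℤ := (X k).toInt - (Y k).toInt

/-- `X` and `Y` agree from `N` on and have the same weight and the same first moment. -/
structure Balanced (X Y : ℕ → Bool) (N : ℕ) : Prop where
  eq_ge : ∀ k, N ≤ k → X k = Y k
  sum_zero : ∑ k ∈ Finset.range N, diff X Y k = 0
  sum_one : ∑ k ∈ Finset.range N, (k : ℤ) * diff X Y k = 0

section

variable {X Y : ℕ → Bool} {N : ℕ}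

theorem diff_swap (k : ℕ) : diff Y X k = -diff X Y k := by simp [diff]

theorem diff_eq_zero {k : ℕ} : diff X Y k = 0 ↔ X k = Y k := by
  unfold diff; cases X k <;> cases Y k <;> simp

theorem diff_of_ne {k : ℕ} (h : X k ≠ Y k) : diff X Y k = 1 ∨ diff X Y k = -1 := by
  revert h; unfold diff; cases X k <;> cases Y k <;> simp

theorem Balanced.swap (h : Balanced X Y N) : Balanced Y X N where
  eq_ge k hk := (h.eq_ge k hk).symm
  sum_zero := by simp [diff_swap (X := X), h.sum_zero]
  sum_one := by simp [diff_swap (X := X), h.sum_one]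

theorem Balanced.lt_of_ne (h : Balanced X Y N) {k : ℕ} (hk : X k ≠ Y k) : k < N := by
  by_contra hN
  exact hk (h.eq_ge k (by omega))

theorem Balanced.sum_eq (h : Balanced X Y N) (s : Finset ℕ) (hs : ∀ k, X k ≠ Y k → k ∈ s) :
    ∑ k ∈ s, diff X Y k = 0 ∧ ∑ k ∈ s, (k : ℤ) * diff X Y k = 0 := by
  have key : ∀ f : ℕ → ℤ, (∀ k, X k = Y k → f k = 0) →
      ∑ k ∈ s, f k = ∑ k ∈ Finset.range N, f k := by
    intro f hf
    rw [← Finset.sum_filter_of_ne (s := s) (p := fun k => X k ≠ Y k)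
        (fun k _ hk hXY => hk (hf k hXY)),
      ← Finset.sum_filter_of_ne (s := Finset.range N) (p := fun k => X k ≠ Y k)
        (fun k _ hk hXY => hk (hf k hXY))]
    refine Finset.sum_congr ?_ fun _ _ => rfl
    ext k
    simp only [Finset.mem_filter, Finset.mem_range]
    exact ⟨fun hk => ⟨h.lt_of_ne hk.2, hk.2⟩, fun hk => ⟨hs k hk.2, hk.2⟩⟩
  rw [key _ fun k hk => diff_eq_zero.2 hk, key _ fun k hk => by rw [diff_eq_zero.2 hk, mul_zero]]
  exact ⟨h.sum_zero, h.sum_one⟩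

theorem exists_next {P : ℕ → Prop} {a b : ℕ} (hab : a < b) (hb : P b) :
    ∃ c, a < c ∧ c ≤ b ∧ P c ∧ ∀ m, a < m → m < c → ¬P m := by
  classical
  have hex : ∃ c, a < c ∧ P c := ⟨b, hab, hb⟩
  exact ⟨Nat.find hex, (Nat.find_spec hex).1, Nat.find_min' hex ⟨hab, hb⟩, (Nat.find_spec hex).2,
    fun m h₁ h₂ h₃ => Nat.find_min hex h₂ ⟨h₁, h₃⟩⟩

theorem exists_prev {P : ℕ → Prop} {a b : ℕ} (hab : a < b) (ha : P a) :
    ∃ c, a ≤ c ∧ c < b ∧ P c ∧ ∀ m, c < m → m < b → ¬P m := by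
  classical
  have h := Nat.findGreatest_spec (P := P) (n := b - 1) (m := a) (by omega) ha
  have h₁ := Nat.le_findGreatest (P := P) (n := b - 1) (m := a) (by omega) ha
  have h₂ := Nat.findGreatest_le (P := P) (b - 1)
  exact ⟨Nat.findGreatest P (b - 1), h₁, by omega, h,
    fun m k₁ k₂ => Nat.findGreatest_is_greatest k₁ (by omega)⟩

theorem Balanced.exists_window (h : Balanced X Y N) (hXY : X ≠ Y) :
    ∃ p₁ p₂ p₃ q₃ q₂ q₁, Window X Y p₁ p₂ p₃ q₃ q₂ q₁ := by
  classical
  obtain ⟨k, hk⟩ : ∃ k, X k ≠ Y k := by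
    by_contra! hc
    exact hXY (funext hc)
  have hex : ∃ k, X k ≠ Y k := ⟨k, hk⟩
  set p₁ := Nat.find hex with hp₁
  have np1 : X p₁ ≠ Y p₁ := Nat.find_spec hex
  have e0 : ∀ m, m < p₁ → X m = Y m := fun m hm => not_not.1 (Nat.find_min hex hm)
  obtain ⟨q₁, l1, -, nq1, f0⟩ := exists_prev (P := fun k => X k ≠ Y k) (h.lt_of_ne np1) np1
  have eqRight : ∀ m, q₁ < m → X m = Y m := fun m hm => by
    by_cases hN : m < N
    · exact not_not.1 (f0 m hm hN)
    · exact h.eq_ge m (by omega)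
  have l1' : p₁ < q₁ := by
    rcases l1.lt_or_eq with hl | hl
    · exact hl
    · have := (h.sum_eq {p₁} fun k hk => by
        rw [Finset.mem_singleton]
        by_contra hne
        rcases Nat.lt_or_gt_of_ne hne with hh | hh
        · exact hk (e0 k hh)
        · exact hk (eqRight k (by omega))).1
      rw [Finset.sum_singleton] at this
      exact (np1 (diff_eq_zero.1 this)).elim
  obtain ⟨p₂, l2, l3, np2, e12⟩ := exists_next (P := fun k => X k ≠ Y k) l1' nq1
  have l3' : p₂ < q₁ := by
    rcases l3.lt_or_eq with hl | hl
    · exact hl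
    · have := h.sum_eq {p₁, q₁} fun k hk => by
        simp only [Finset.mem_singleton, Finset.mem_insert]
        by_contra! hne
        rcases Nat.lt_or_gt_of_ne hne.1 with hh | hh
        · exact hk (e0 k hh)
        · rcases Nat.lt_or_gt_of_ne hne.2 with hh' | hh'
          · exact e12 k hh (by omega) hk
          · exact hk (eqRight k (by omega))
      rw [Finset.sum_pair l1'.ne, Finset.sum_pair l1'.ne] at this
      have h2 : ((q₁ : ℤ) - p₁) * diff X Y q₁ = 0 := by
        linear_combination this.2 - (p₁ : ℤ) * this.1
      rcases mul_eq_zero.1 h2 with h3 | h3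
      · omega
      · exact (nq1 (diff_eq_zero.1 h3)).elim
  obtain ⟨q₂, l4, l5, nq2, f21⟩ := exists_prev (P := fun k => X k ≠ Y k) l3' np2
  have l4' : p₂ < q₂ := by
    rcases l4.lt_or_eq with hl | hl
    · exact hl
    · have := (h.sum_eq {p₁, p₂, q₁} fun k hk => by
        simp only [Finset.mem_singleton, Finset.mem_insert]
        by_contra! hne
        rcases Nat.lt_or_gt_of_ne hne.1 with hh | hh
        · exact hk (e0 k hh)
        rcases Nat.lt_or_gt_of_ne hne.2.1 with hh | hh
        · exact e12 k (by omega) hh hk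
        rcases Nat.lt_or_gt_of_ne hne.2.2 with hh' | hh'
        · exact f21 k (by omega) hh' hk
        · exact hk (eqRight k (by omega))).1
      rw [Finset.sum_insert (by simp; omega), Finset.sum_pair l3'.ne] at this
      have a1 := diff_of_ne np1
      have a2 := diff_of_ne np2
      have a3 := diff_of_ne nq1
      omega
  obtain ⟨p₃, l6, l7, np3, e23⟩ := exists_next (P := fun k => X k ≠ Y k) l4' nq2
  obtain ⟨q₃, l8, l9, nq3, f32⟩ := exists_prev (P := fun k => X k ≠ Y k) l4' np2
  exact ⟨p₁, p₂, p₃, q₃, q₂, q₁, l2, l6, l9, l5, l8, l7, np1, np2, np3, nq1, nq2, nq3, e0,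
    fun m a b => not_not.1 (e12 m a b), fun m a b => not_not.1 (e23 m a b),
    fun m a b => not_not.1 (f32 m a b), fun m a b => not_not.1 (f21 m a b), eqRight⟩

/-- The partial sums of the difference of two binary sequences. -/
def partialDiff (X Y : ℕ → Bool) (k : ℕ) : ℤ := ∑ l ∈ Finset.range k, diff X Y l

theorem partialDiff_succ (k : ℕ) : partialDiff X Y (k + 1) = partialDiff X Y k + diff X Y k :=
  Finset.sum_range_succ _ _

theorem partialDiff_eq {a b : ℕ} (hab : a ≤ b) (h : ∀ k, a ≤ k → k < b → X k = Y k) :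
    partialDiff X Y b = partialDiff X Y a := by
  induction b, hab using Nat.le_induction with
  | base => rfl
  | succ n hn ih =>
    rw [partialDiff_succ, diff_eq_zero.2 (h n hn (by omega)), add_zero]
    exact ih fun k h₁ h₂ => h k h₁ (by omega)

theorem sum_partialDiff (n : ℕ) : ∑ k ∈ Finset.range n, partialDiff X Y (k + 1) =
    n * partialDiff X Y n - ∑ k ∈ Finset.range n, (k : ℤ) * diff X Y k := by
  induction n with
  | zero => simp
  | succ n ih =>
    rw [Finset.sum_range_succ, ih, Finset.sum_range_succ, partialDiff_succ]
    push_cast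
    ring

theorem Balanced.sum_partialDiff_eq_zero (h : Balanced X Y N) :
    ∑ k ∈ Finset.range N, partialDiff X Y (k + 1) = 0 := by
  rw [sum_partialDiff, h.sum_one, partialDiff, h.sum_zero]; simp

variable {p₁ p₂ p₃ q₃ q₂ q₁ : ℕ}

theorem Window.partialDiff_left (w : Window X Y p₁ p₂ p₃ q₃ q₂ q₁) {k : ℕ} (hk : k ≤ p₁) :
    partialDiff X Y k = 0 := by
  rw [partialDiff_eq (Nat.zero_le k) fun m _ h => w.eq_lt m (by omega)]
  simp [partialDiff]

theorem Window.partialDiff_right (w : Window X Y p₁ p₂ p₃ q₃ q₂ q₁) (h : Balanced X Y N) {k : ℕ}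
    (hk : q₁ < k) : partialDiff X Y k = 0 := by
  have hN := h.lt_of_ne w.ne_q1
  have h0 : partialDiff X Y N = 0 := h.sum_zero
  rcases le_total k N with hkN | hkN
  · rw [← partialDiff_eq hkN fun m h₁ _ => w.eq_gt m (by omega), h0]
  · rw [partialDiff_eq hkN fun m h₁ _ => h.eq_ge m h₁, h0]

theorem toInt_nonneg (b : Bool) : 0 ≤ b.toInt := by cases b <;> simp

theorem toInt_le_one (b : Bool) : b.toInt ≤ 1 := by cases b <;> simp

/-- The shifted comparison has a mismatch between the second and the last but one difference. -/
theorem Window.exists_mismatch (w : Window X Y p₁ p₂ p₃ q₃ q₂ q₁) (h : Balanced X Y N) :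
    ∃ τ, p₂ ≤ τ ∧ τ < q₂ ∧ X (τ + 1) ≠ Y τ := by
  by_contra! hc
  have hN := h.lt_of_ne w.ne_q1
  have k1 := w.p12
  have k2 := w.p23
  have k3 := w.qp
  have k4 := w.q21
  have s1 : partialDiff X Y (p₁ + 1) = diff X Y p₁ := by
    rw [partialDiff_succ, w.partialDiff_left le_rfl, zero_add]
  have s2 : ∀ k, p₁ < k → k ≤ p₂ → partialDiff X Y k = diff X Y p₁ := fun k a b => by
    rw [← s1]
    exact partialDiff_eq a fun m c d => w.eq_p12 m (by omega) (by omega)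
  have s3 : ∀ k, p₂ ≤ k → k ≤ q₂ →
      partialDiff X Y (k + 1) = diff X Y p₁ + (X p₂).toInt - (Y k).toInt := by
    intro k hk
    induction k, hk using Nat.le_induction with
    | base =>
      intro _
      rw [partialDiff_succ, s2 p₂ k1 le_rfl, diff, diff]; ring
    | succ n hn ih =>
      intro hq
      rw [partialDiff_succ, ih (by omega), diff, diff, hc n hn (by omega)]; ring
  have s4 : ∀ k, q₂ < k → k ≤ q₁ → partialDiff X Y k = partialDiff X Y (q₂ + 1) := fun k a b =>
    partialDiff_eq a fun m c d => w.eq_q21 m (by omega) (by omega)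
  have s5 : ∀ k, q₁ < k → partialDiff X Y k = 0 := fun k hk => w.partialDiff_right h hk
  have s3' := s3 q₂ (by omega) le_rfl
  have x0 := toInt_nonneg (X p₂)
  have x1 := toInt_le_one (X p₂)
  have hsum := h.sum_partialDiff_eq_zero
  rcases diff_of_ne w.ne_p1 with hε | hε
  · have hpos : 0 < ∑ k ∈ Finset.range N, partialDiff X Y (k + 1) := by
      refine Finset.sum_pos' (fun k _ => ?_) ⟨p₁, Finset.mem_range.2 (by omega), by omega⟩
      have y1 := toInt_le_one (Y k)
      have y2 := toInt_le_one (Y q₂)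
      rcases lt_or_ge k p₁ with c | c
      · rw [w.partialDiff_left (by omega)]
      rcases lt_or_ge k p₂ with c | c
      · rw [s2 (k + 1) (by omega) (by omega)]; omega
      rcases le_or_gt k q₂ with c' | c'
      · rw [s3 k c c']; omega
      rcases lt_or_ge k q₁ with c' | c'
      · rw [s4 (k + 1) (by omega) (by omega)]; omega
      · rw [s5 (k + 1) (by omega)]
    omega
  · have hpos : 0 < ∑ k ∈ Finset.range N, -partialDiff X Y (k + 1) := by
      refine Finset.sum_pos' (fun k _ => ?_) ⟨p₁, Finset.mem_range.2 (by omega), by omega⟩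
      have y1 := toInt_nonneg (Y k)
      have y2 := toInt_nonneg (Y q₂)
      rcases lt_or_ge k p₁ with c | c
      · rw [w.partialDiff_left (by omega)]; simp
      rcases lt_or_ge k p₂ with c | c
      · rw [s2 (k + 1) (by omega) (by omega)]; omega
      rcases le_or_gt k q₂ with c' | c'
      · rw [s3 k c c']; omega
      rcases lt_or_ge k q₁ with c' | c'
      · rw [s4 (k + 1) (by omega) (by omega)]; omega
      · rw [s5 (k + 1) (by omega)]; simp
    rw [Finset.sum_neg_distrib] at hpos
    omega

/-- The positions in the window where `X`, shifted by one, disagrees with `Y`. -/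
def mismatches (X Y : ℕ → Bool) (p q : ℕ) : Finset ℕ :=
  (Finset.Ico p q).filter fun k => X (k + 1) ≠ Y k

theorem mem_mismatches {p q k : ℕ} :
    k ∈ mismatches X Y p q ↔ (p ≤ k ∧ k < q) ∧ X (k + 1) ≠ Y k := by
  simp [mismatches]

theorem Window.card_mismatches_parity (w : Window X Y p₁ p₂ p₃ q₃ q₂ q₁) (h : Balanced X Y N) :
    (mismatches X Y p₁ q₁).card % 2 = (mismatches Y X p₁ q₁).card % 2 := by
  have hpq : p₁ ≤ q₁ := by have := w.p12; have := w.p23; have := w.qp; have := w.q21; omega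
  have key : ∀ q, p₁ ≤ q → (2 : ℤ) ∣ ((mismatches X Y p₁ q).card : ℤ) - (mismatches Y X p₁ q).card
      - (partialDiff X Y (q + 1) + partialDiff X Y q -
        (partialDiff X Y (p₁ + 1) + partialDiff X Y p₁)) := by
    intro q hq
    induction q, hq using Nat.le_induction with
    | base => simp [mismatches]
    | succ n hn ih =>
      have hs : ∀ X Y : ℕ → Bool, ((mismatches X Y p₁ (n + 1)).card : ℤ) =
          (mismatches X Y p₁ n).card + if X (n + 1) ≠ Y n then 1 else 0 := by
        intro X Y
        simp only [mismatches, Finset.card_filter]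
        rw [Finset.sum_Ico_succ_top hn]
        push_cast
        rfl
      rw [hs X Y, hs Y X, partialDiff_succ (n + 1), partialDiff_succ n]
      rw [partialDiff_succ n] at ih
      have hd : (2 : ℤ) ∣ ((if X (n + 1) ≠ Y n then 1 else 0) - if Y (n + 1) ≠ X n then 1 else 0)
          - diff X Y (n + 1) - diff X Y n := by
        unfold diff
        generalize X (n + 1) = a
        generalize X n = b
        generalize Y (n + 1) = c
        generalize Y n = d
        revert a b c d
        decide
      obtain ⟨a, ha⟩ := ih
      obtain ⟨b, hb⟩ := hd
      exact ⟨a + b, by linear_combination ha + hb⟩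
  have hk := key q₁ hpq
  rw [partialDiff_succ p₁, w.partialDiff_left (le_refl p₁),
    w.partialDiff_right h (Nat.lt_succ_self q₁)] at hk
  have hq : partialDiff X Y q₁ = -diff X Y q₁ := by
    have := w.partialDiff_right h (Nat.lt_succ_self q₁)
    rw [Nat.succ_eq_add_one, partialDiff_succ] at this
    omega
  rw [hq] at hk
  have a1 := diff_of_ne w.ne_p1
  have a2 := diff_of_ne w.ne_q1
  omega

theorem sum_alternating_even {f : ℕ → ℤ} {a h : ℕ}
    (hf : ∀ k, a ≤ k → k + 1 < a + 2 * h → f (k + 1) = -f k) :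
    ∑ k ∈ Finset.Ico a (a + 2 * h), f k = 0 ∧
      ∑ k ∈ Finset.Ico a (a + 2 * h), (k : ℤ) * f k = -h * f a ∧
      (∀ k, k < h → f (a + 2 * k) = f a) := by
  induction h with
  | zero => simp
  | succ h ih =>
    obtain ⟨i1, i2, i3⟩ := ih fun k h₁ h₂ => hf k h₁ (by omega)
    have e1 : f (a + 2 * h) = f a := by
      rcases Nat.eq_zero_or_pos h with h0 | h0
      · simp [h0]
      · have c1 := i3 (h - 1) (by omega)
        have c2 := hf (a + 2 * (h - 1)) (by omega) (by omega)
        have c3 := hf (a + 2 * (h - 1) + 1) (by omega) (by omega)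
        rw [show a + 2 * (h - 1) + 1 + 1 = a + 2 * h by omega] at c3
        rw [c3, c2, c1, neg_neg]
    have e2 := hf (a + 2 * h) (by omega) (by omega)
    rw [show a + 2 * (h + 1) = a + 2 * h + 1 + 1 by ring,
      Finset.sum_Ico_succ_top (by omega), Finset.sum_Ico_succ_top (by omega),
      Finset.sum_Ico_succ_top (by omega), Finset.sum_Ico_succ_top (by omega), i1, i2, e2, e1]
    refine ⟨by ring, by push_cast; ring, fun k hk => ?_⟩
    rcases Nat.lt_succ_iff_lt_or_eq.1 hk with hk | rfl
    · exact i3 k hk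
    · exact e1

end
section

variable {X Y : ℕ → Bool} {N p₁ p₂ p₃ q₃ q₂ q₁ : ℕ}

/-- If the comparisons of `X` and `Y` shifted against each other in both directions have a single
mismatch each, then the differing positions form two blocks of the same length. -/
theorem Window.blocks (w : Window X Y p₁ p₂ p₃ q₃ q₂ q₁) (h : Balanced X Y N) {τ s : ℕ}
    (hτs : τ ≤ s) (hτ₁ : p₁ ≤ τ) (hs₂ : s < q₁)
    (hτ : X (τ + 1) ≠ Y τ) (hu : ∀ m, p₁ ≤ m → m < q₁ → m ≠ τ → X (m + 1) = Y m)
    (hv : ∀ m, p₁ ≤ m → m < q₁ → m ≠ s → Y (m + 1) = X m) :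
    (p₃ ≤ τ ∧ s < q₃) ∨ (p₂ = τ ∧ p₂ = p₁ + 1 ∧ q₂ = s + 1 ∧ q₁ = s + 2 ∧
      ∀ m, τ ≤ m → m ≤ s + 1 → X m = X τ) := by
  have alt : ∀ k, p₁ ≤ k → k < q₁ → k ≠ τ → k ≠ s → diff X Y (k + 1) = -diff X Y k :=
    fun k a b c d => by rw [diff, diff, hu k a b c, hv k a b d]; ring
  have left : ∀ k, p₁ ≤ k → k ≤ τ → X k ≠ Y k := by
    intro k hk
    induction k, hk using Nat.le_induction with
    | base => exact fun _ => w.ne_p1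
    | succ n hn ih =>
      intro hle
      rw [hu n hn (by omega) (by omega), hv n hn (by omega) (by omega)]
      exact (ih (by omega)).symm
  have mid : ∀ k, τ ≤ k → k ≤ s → X k = X τ ∧ (τ < k → Y k = X τ) := by
    intro k hk
    induction k, hk using Nat.le_induction with
    | base => exact fun _ => ⟨rfl, fun h => (lt_irrefl _ h).elim⟩
    | succ n hn ih =>
      intro hle
      obtain ⟨i1, i2⟩ := ih (by omega)
      refine ⟨?_, fun _ => by rw [hv n (by omega) (by omega) (by omega), i1]⟩
      rcases hn.lt_or_eq with hn' | rfl
      · rw [hu n (by omega) (by omega) (by omega), i2 hn']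
      · exact bool_eq_of_ne hτ (left τ hτ₁ le_rfl)
  have xs : X (s + 1) = X τ := by
    obtain ⟨i1, i2⟩ := mid s hτs le_rfl
    rcases hτs.lt_or_eq with hn' | rfl
    · rw [hu s (by omega) (by omega) (by omega), i2 hn']
    · exact bool_eq_of_ne hτ (left τ hτ₁ le_rfl)
  have right : ∀ j k, q₁ = k + j → s < k → X k ≠ Y k := by
    intro j
    induction j with
    | zero => rintro k hk -; rw [show k = q₁ by omega]; exact w.ne_q1
    | succ n ih =>
      intro k hk hsk e
      apply ih (k + 1) (by omega) (by omega)
      rw [hu k (by omega) (by omega) (by omega), hv k (by omega) (by omega) (by omega), e]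
  replace right : ∀ k, s < k → k ≤ q₁ → X k ≠ Y k := fun k a b =>
    right (q₁ - k) k (by omega) a
  have dτ : diff X Y (s + 1) = diff X Y τ := by
    have a := left τ hτ₁ le_rfl
    have b := right (s + 1) (by omega) (by omega)
    rw [xs] at b
    rw [diff, diff, xs, bool_eq_of_ne b.symm a.symm]
  have nτ := diff_of_ne (left τ hτ₁ le_rfl)
  have supp : ∀ k, X k ≠ Y k → k ∈ Finset.Ico p₁ (τ + 1) ∪ Finset.Ico (s + 1) (q₁ + 1) := by
    intro k hk
    simp only [Finset.mem_union, Finset.mem_Ico]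
    by_contra! hc
    rcases lt_or_ge k p₁ with c | c
    · exact hk (w.eq_lt k c)
    have c1 := hc.1 c
    rcases lt_or_ge k (s + 1) with c2 | c2
    · obtain ⟨i1, i2⟩ := mid k (by omega) (by omega)
      exact hk (by rw [i1, i2 (by omega)])
    · exact hk (w.eq_gt k (by have := hc.2 c2; omega))
  obtain ⟨z0, z1⟩ := h.sum_eq _ supp
  have disj : Disjoint (Finset.Ico p₁ (τ + 1)) (Finset.Ico (s + 1) (q₁ + 1)) := by
    rw [Finset.disjoint_left]
    intro k
    simp only [Finset.mem_Ico]
    omega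
  rw [Finset.sum_union disj] at z0 z1
  obtain ⟨a, ha⟩ := Nat.even_or_odd' (τ + 1 - p₁)
  obtain ⟨b, hb⟩ := Nat.even_or_odd' (q₁ - s)
  obtain ⟨A0, A1, A2⟩ := sum_alternating_even (f := diff X Y) (a := p₁) (h := a)
    fun k c d => alt k c (by omega) (by omega) (by omega)
  obtain ⟨B0, B1, B2⟩ := sum_alternating_even (f := diff X Y) (a := s + 1) (h := b)
    fun k c d => alt k (by omega) (by omega) (by omega) (by omega)
  have hlen : 1 ≤ a ∧ τ + 1 = p₁ + 2 * a ∧ q₁ = s + 2 * a := by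
    rcases ha with ha | ha
    · have eτ : diff X Y p₁ = -diff X Y τ := by
        have c1 := A2 (a - 1) (by omega)
        have c2 := alt (p₁ + 2 * (a - 1)) (by omega) (by omega) (by omega) (by omega)
        rw [show p₁ + 2 * (a - 1) + 1 = τ by omega, c1] at c2
        omega
      rcases hb with hb | hb
      · rw [show τ + 1 = p₁ + 2 * a by omega, show q₁ + 1 = s + 1 + 2 * b by omega, A1, B1,
          eτ, dτ] at z1
        have : (a : ℤ) = b := by
          rcases nτ with e | e <;> rw [e] at z1 <;> linarith
        omega
      · rw [show τ + 1 = p₁ + 2 * a by omega, show q₁ + 1 = s + 1 + 2 * b + 1 by omega, A0,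
          Finset.sum_Ico_succ_top (by omega), B0] at z0
        have := diff_of_ne (right (s + 1 + 2 * b) (by omega) (by omega))
        omega
    · have oddA : ∑ k ∈ Finset.Ico p₁ (τ + 1), diff X Y k = diff X Y τ := by
        rw [Finset.sum_Ico_succ_top (by omega), show τ = p₁ + 2 * a by omega, A0, zero_add]
      rw [oddA] at z0
      rcases hb with hb | hb
      · rw [show q₁ + 1 = s + 1 + 2 * b by omega, B0] at z0
        omega
      · have hlast : diff X Y (s + 1 + 2 * b) = diff X Y (s + 1) := by
          rcases Nat.eq_zero_or_pos b with hb0 | hb0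
          · simp [hb0]
          have c1 := B2 (b - 1) (by omega)
          have c2 := alt (s + 1 + 2 * (b - 1)) (by omega) (by omega) (by omega) (by omega)
          have c3 := alt (s + 1 + 2 * (b - 1) + 1) (by omega) (by omega) (by omega) (by omega)
          rw [show s + 1 + 2 * (b - 1) + 1 + 1 = s + 1 + 2 * b by omega] at c3
          rw [c3, c2, c1, neg_neg]
        rw [show q₁ + 1 = s + 1 + 2 * b + 1 by omega, Finset.sum_Ico_succ_top (by omega), B0,
          hlast, dτ] at z0
        omega
  obtain ⟨l1, l2, l3⟩ := hlen
  have k1 := w.p12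
  have k2 := w.p23
  have k3 := w.q32
  have k4 := w.q21
  have e2 : p₂ = p₁ + 1 := by
    by_contra hne
    exact left (p₁ + 1) (by omega) (by omega) (w.eq_p12 _ (by omega) (by omega))
  have f2 : q₂ = q₁ - 1 := by
    by_contra hne
    exact right (q₁ - 1) (by omega) (by omega) (w.eq_q21 _ (by omega) (by omega))
  rcases Nat.lt_or_ge a 2 with ha2 | ha2
  · right
    refine ⟨by omega, e2, by omega, by omega, fun m c d => ?_⟩
    rcases Nat.lt_or_ge m (s + 1) with hm | hm
    · exact (mid m c (by omega)).1
    · rw [show m = s + 1 by omega, xs]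
  · left
    constructor
    · by_contra hne
      exact left (p₁ + 2) (by omega) (by omega) (w.eq_p23 _ (by omega) (by omega))
    · by_contra hne
      exact right (q₁ - 2) (by omega) (by omega) (w.eq_q32 _ (by omega) (by omega))

end
section

variable {X Y : ℕ → Bool} {N p₁ p₂ p₃ q₃ q₂ q₁ : ℕ}

theorem exists_list_of_three_le (w : Window X Y p₁ p₂ p₃ q₃ q₂ q₁) (h : Balanced X Y N)
    (hc : 3 ≤ (mismatches X Y p₁ q₁).card) :
    ∃ l : List (ℕ → Bool), l.length ≤ 5 ∧ ∀ Z ∈ shiftSet X Y, Z ∈ l := by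
  obtain ⟨a, ha, b, hb, c, hc, hab, hac, hbc⟩ := Finset.two_lt_card.1 hc
  simp only [mem_mismatches] at ha hb hc
  obtain ⟨W, hW⟩ := shiftSet_of_three w (w.exists_mismatch h) hab hac hbc ha.1.1 ha.1.2 hb.1.1
    hb.1.2 hc.1.1 hc.1.2 ha.2 hb.2 hc.2
  refine ⟨[W, flipAt (del q₁ Y) p₁, flipAt (del q₁ Y) p₂, flipAt (del p₁ X) (q₁ - 1),
    flipAt (del p₁ X) (q₂ - 1)], le_rfl, fun Z hZ => ?_⟩
  simpa using hW Z hZ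

theorem exists_list_of_two_le (w : Window X Y p₁ p₂ p₃ q₃ q₂ q₁) (h : Balanced X Y N)
    (hc : 2 ≤ (mismatches X Y p₁ q₁).card) :
    ∃ l : List (ℕ → Bool), l.length ≤ 6 ∧ ∀ Z ∈ shiftSet X Y, Z ∈ l := by
  rcases hc.lt_or_eq with hc | hc
  · obtain ⟨l, h₁, h₂⟩ := exists_list_of_three_le w h hc
    exact ⟨l, by omega, h₂⟩
  obtain ⟨a, b, hab, he⟩ := Finset.card_eq_two.1 hc.symm
  have hmem : ∀ k, (p₁ ≤ k ∧ k < q₁) ∧ X (k + 1) ≠ Y k ↔ k = a ∨ k = b := fun k => by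
    rw [← mem_mismatches, he]; simp
  have ha := (hmem a).2 (Or.inl rfl)
  have hb := (hmem b).2 (Or.inr rfl)
  refine ⟨[flipAt (del q₁ Y) a, flipAt (del q₁ Y) b, flipAt (del q₁ Y) p₁, flipAt (del q₁ Y) p₂,
    flipAt (del p₁ X) (q₁ - 1), flipAt (del p₁ X) (q₂ - 1)], le_rfl, fun Z hZ => ?_⟩
  simpa using shiftSet_of_two w (w.exists_mismatch h) hab ha.1.1 ha.1.2 hb.1.1 hb.1.2 ha.2 hb.2
    (fun m h₁ h₂ h₃ h₄ => by
      by_contra hne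
      exact ((hmem m).1 ⟨⟨h₁, h₂⟩, hne⟩).elim h₃ h₄) Z hZ

theorem exists_unique_of_card_eq_one (hc : (mismatches X Y p₁ q₁).card = 1) :
    ∃ τ, p₁ ≤ τ ∧ τ < q₁ ∧ X (τ + 1) ≠ Y τ ∧
      ∀ m, p₁ ≤ m → m < q₁ → m ≠ τ → X (m + 1) = Y m := by
  obtain ⟨a, he⟩ := Finset.card_eq_one.1 hc
  have hmem : ∀ k, (p₁ ≤ k ∧ k < q₁) ∧ X (k + 1) ≠ Y k ↔ k = a := fun k => by
    rw [← mem_mismatches, he]; simp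
  have ha := (hmem a).2 rfl
  refine ⟨a, ha.1.1, ha.1.2, ha.2, fun m h₁ h₂ h₃ => ?_⟩
  by_contra hne
  exact h₃ ((hmem m).1 ⟨⟨h₁, h₂⟩, hne⟩)

theorem exists_list_of_one (w : Window X Y p₁ p₂ p₃ q₃ q₂ q₁) (h : Balanced X Y N)
    (hc : (mismatches X Y p₁ q₁).card = 1) :
    ∃ l : List (ℕ → Bool), l.length ≤ 8 ∧ ∀ Z ∈ shiftSet X Y, Z ∈ l := by
  obtain ⟨τ, h₁, h₂, h₃, h₄⟩ := exists_unique_of_card_eq_one hc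
  obtain ⟨t₀, s₀, hl⟩ := shiftSet_of_one w (w.exists_mismatch h) h₁ h₂ h₃ h₄
  refine ⟨[del q₁ Y, del p₁ X, flipAt (del q₁ Y) t₀, flipAt (del p₁ X) s₀, flipAt (del q₁ Y) p₁,
    flipAt (del p₁ X) (q₁ - 1), flipAt (del q₁ Y) p₂, flipAt (del p₁ X) (q₂ - 1)], le_rfl,
    fun Z hZ => ?_⟩
  have := hl Z hZ
  simp only [List.mem_cons, List.not_mem_nil, or_false]
  tauto

theorem exists_list_of_one_one (w : Window X Y p₁ p₂ p₃ q₃ q₂ q₁) (h : Balanced X Y N) {τ s : ℕ}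
    (hτs : τ ≤ s) (hτ₁ : p₁ ≤ τ) (hs₂ : s < q₁)
    (hτ : X (τ + 1) ≠ Y τ) (hu : ∀ m, p₁ ≤ m → m < q₁ → m ≠ τ → X (m + 1) = Y m)
    (hs : Y (s + 1) ≠ X s) (hv : ∀ m, p₁ ≤ m → m < q₁ → m ≠ s → Y (m + 1) = X m) :
    ∃ l : List (ℕ → Bool), l.length ≤ 13 ∧ ∀ Z ∈ shiftSet X Y ∪ shiftSet Y X, Z ∈ l := by
  obtain ⟨t₀, s₀, hl⟩ := shiftSet_of_one w (w.exists_mismatch h) hτ₁ (by omega) hτ hu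
  obtain ⟨t₁, s₁, hr⟩ := shiftSet_of_one w.swap (w.swap.exists_mismatch h.swap) (by omega) hs₂ hs hv
  rcases w.blocks h hτs hτ₁ hs₂ hτ hu hv with ⟨c₁, c₂⟩ | ⟨rfl, c₁, rfl, rfl, c₂⟩
  · refine ⟨[del q₁ Y, del p₁ X, flipAt (del q₁ Y) t₀, flipAt (del p₁ X) s₀,
      flipAt (del q₁ Y) p₁, flipAt (del p₁ X) (q₁ - 1), del q₁ X, del p₁ Y, flipAt (del q₁ X) t₁,
      flipAt (del p₁ Y) s₁, flipAt (del q₁ X) p₁, flipAt (del p₁ Y) (q₁ - 1)], by simp,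
      fun Z hZ => ?_⟩
    have n₁ : ¬∀ m, p₃ ≤ m → m < q₁ → X (m + 1) = Y m := fun e => hτ (e τ c₁ (by omega))
    have n₂ : ¬∀ m, p₁ ≤ m → m < q₃ → X (m + 1) = Y m := fun e => hτ (e τ hτ₁ (by omega))
    have n₃ : ¬∀ m, p₃ ≤ m → m < q₁ → Y (m + 1) = X m := fun e => hs (e s (by omega) hs₂)
    have n₄ : ¬∀ m, p₁ ≤ m → m < q₃ → Y (m + 1) = X m := fun e => hs (e s (by omega) c₂)
    simp only [List.mem_cons, List.not_mem_nil, or_false]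
    rcases hZ with hZ | hZ
    · have := hl Z hZ
      tauto
    · have := hr Z hZ
      tauto
  · have o₁ := (w.del_eq_flipAt_of_unique hτ₁ (by omega) hτ hu).1
    have o₂ := (w.swap.del_eq_flipAt_of_unique (by omega) hs₂ hs hv).2
    have x₁ : X p₁ ≠ X p₂ := by
      have := hu p₁ le_rfl (by omega) (by omega)
      rw [c₁, this]
      exact w.ne_p1
    have x₂ : X (s + 2) ≠ X p₂ := by
      rw [hu (s + 1) (by omega) (by omega) (by omega), ← c₂ (s + 1) (by omega) le_rfl]
      exact w.ne_q2.symm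
    have o₃ : flipAt (del (s + 2) X) p₁ = flipAt (del p₁ X) (s + 2 - 1) := by
      refine eq_flipAt (fun m hm => ?_) ?_
      · rcases lt_trichotomy m p₁ with hm' | rfl | hm'
        · simp [flipAt, del, hm', show m ≠ p₁ by omega, show m < s + 2 by omega]
        · have : del (s + 2) X m ≠ X p₂ := by simpa [del, show m < s + 2 by omega] using x₁
          simpa [flipAt, del, ← c₁, Bool.not_eq_eq_eq_not, Bool.eq_not] using this
        · rcases Nat.lt_or_ge m (s + 2) with hm2 | hm2
          · simp [flipAt, del, show m ≠ p₁ by omega, hm2, show ¬m < p₁ by omega,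
              c₂ m (by omega) (by omega), c₂ (m + 1) (by omega) (by omega)]
          · simp [flipAt, del, show m ≠ p₁ by omega, show ¬m < s + 2 by omega,
              show ¬m < p₁ by omega]
      · have : del p₁ X (s + 1) ≠ X p₂ := by simpa [del, show ¬s + 1 < p₁ by omega] using x₂
        simpa [flipAt, show s + 1 ≠ p₁ by omega, del, show ¬s + 1 < p₁ by omega,
          c₂ (s + 1) (by omega) le_rfl] using this.symm
    refine ⟨[del (s + 2) Y, del p₁ X, flipAt (del (s + 2) Y) t₀, flipAt (del p₁ X) s₀,
      flipAt (del (s + 2) Y) p₁, flipAt (del p₁ X) (s + 2 - 1), flipAt (del p₁ X) (s + 1 - 1),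
      del (s + 2) X, del p₁ Y, flipAt (del (s + 2) X) t₁, flipAt (del p₁ Y) s₁,
      flipAt (del p₁ Y) (s + 2 - 1), flipAt (del (s + 2) X) p₂], by simp, fun Z hZ => ?_⟩
    rcases hZ with hZ | hZ
    · have := hl Z hZ
      rw [← o₁] at this
      simp only [List.mem_cons, List.not_mem_nil, or_false]
      tauto
    · have := hr Z hZ
      rw [Nat.add_sub_cancel s 1, ← o₂, o₃] at this
      simp only [List.mem_cons, List.not_mem_nil, or_false]
      tauto

/-- Two distinct balanced sequences have at most 13 common neighbours. -/
theorem Balanced.exists_list (h : Balanced X Y N) (hXY : X ≠ Y) :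
    ∃ l : List (ℕ → Bool), l.length ≤ 13 ∧ ∀ Z ∈ shiftSet X Y ∪ shiftSet Y X, Z ∈ l := by
  obtain ⟨p₁, p₂, p₃, q₃, q₂, q₁, w⟩ := h.exists_window hXY
  have join : ∀ a b, a + b ≤ 13 →
      (∃ l : List (ℕ → Bool), l.length ≤ a ∧ ∀ Z ∈ shiftSet X Y, Z ∈ l) →
      (∃ l : List (ℕ → Bool), l.length ≤ b ∧ ∀ Z ∈ shiftSet Y X, Z ∈ l) →
      ∃ l : List (ℕ → Bool), l.length ≤ 13 ∧ ∀ Z ∈ shiftSet X Y ∪ shiftSet Y X, Z ∈ l := by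
    rintro a b hab ⟨l, hl, hl'⟩ ⟨r, hr, hr'⟩
    refine ⟨l ++ r, by rw [List.length_append]; omega, fun Z hZ => List.mem_append.2 ?_⟩
    exact hZ.imp (hl' Z) (hr' Z)
  have pos : ∀ {X Y : ℕ → Bool}, Window X Y p₁ p₂ p₃ q₃ q₂ q₁ → Balanced X Y N →
      1 ≤ (mismatches X Y p₁ q₁).card := fun w h => by
    obtain ⟨τ, h₁, h₂, h₃⟩ := w.exists_mismatch h
    have := w.p12
    have := w.q21
    exact Finset.card_pos.2 ⟨τ, mem_mismatches.2 ⟨⟨by omega, by omega⟩, h₃⟩⟩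
  have par := w.card_mismatches_parity h
  have pX := pos w h
  have pY := pos w.swap h.swap
  rcases pX.lt_or_eq with hX | hX <;> rcases pY.lt_or_eq with hY | hY
  · exact join 6 6 (by norm_num) (exists_list_of_two_le w h hX)
      (exists_list_of_two_le w.swap h.swap hY)
  · exact join 5 8 (by norm_num) (exists_list_of_three_le w h (by omega))
      (exists_list_of_one w.swap h.swap hY.symm)
  · exact join 8 5 (by norm_num) (exists_list_of_one w h hX.symm)
      (exists_list_of_three_le w.swap h.swap (by omega))
  · obtain ⟨τ, a₁, a₂, a₃, a₄⟩ := exists_unique_of_card_eq_one hX.symm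
    obtain ⟨s, b₁, b₂, b₃, b₄⟩ := exists_unique_of_card_eq_one hY.symm
    rcases le_total τ s with hle | hle
    · exact exists_list_of_one_one w h hle a₁ b₂ a₃ a₄ b₃ b₄
    · rw [Set.union_comm]
      exact exists_list_of_one_one w.swap h.swap hle b₁ a₂ b₃ b₄ a₃ a₄

end

/-- A finite binary sequence, continued by zeros. -/
def extend {n : ℕ} (x : BinSeq n) : ℕ → Bool := fun m =>
  if h : m < n then decide (x ⟨m, h⟩ = 1) else false

theorem extend_apply {n : ℕ} (x : BinSeq n) (i : Fin n) : extend x i = decide (x i = 1) := by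
  simp [extend]

theorem extend_of_le {n : ℕ} (x : BinSeq n) {m : ℕ} (h : n ≤ m) : extend x m = false := by
  simp [extend, Nat.not_lt.2 h]

theorem toInt_extend {n : ℕ} (x : BinSeq n) (i : Fin n) : (extend x i).toInt = ((x i : ℕ) : ℤ) := by
  rw [extend_apply]
  generalize x i = a
  revert a
  decide

theorem extend_injective {n : ℕ} : Function.Injective (extend (n := n)) := by
  intro x y h
  funext i
  have h1 : (extend x i).toInt = (extend y i).toInt := by rw [h]
  rw [toInt_extend, toInt_extend] at h1
  exact Fin.ext (by exact_mod_cast h1)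

theorem exists_succAbove_of_strictMono {k : ℕ} {f : Fin k → Fin (k + 1)} (hf : StrictMono f) :
    ∃ i : Fin (k + 1), f = i.succAbove := by
  classical
  have hne : ¬Function.Surjective f := fun h => by
    have := Fintype.card_le_of_surjective f h
    simp at this
  obtain ⟨i, hi⟩ : ∃ i, ∀ a, f a ≠ i := by
    simpa [Function.Surjective] using hne
  refine ⟨i, (hf.range_inj (Fin.strictMono_succAbove i)).1 ?_⟩
  rw [Fin.range_succAbove]
  have hsub : (Finset.univ.image f) ⊆ {i}ᶜ := by
    intro a ha
    obtain ⟨b, -, rfl⟩ := Finset.mem_image.1 ha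
    simpa using hi b
  have := Finset.eq_of_subset_of_card_le hsub (by
    rw [Finset.card_image_of_injective _ hf.injective, Finset.card_compl]
    simp)
  have h2 := congrArg (fun s : Finset (Fin (k + 1)) => (s : Set (Fin (k + 1)))) this
  simpa using h2

theorem extend_comp_succAbove {k : ℕ} (x : BinSeq (k + 1)) (i : Fin (k + 1)) :
    extend (n := k) (x ∘ i.succAbove) = del i (extend x) := by
  funext m
  by_cases hm : m < k
  · have h1 := extend_apply (n := k) (x ∘ i.succAbove) ⟨m, hm⟩
    simp only [Function.comp] at h1
    rw [show extend (n := k) (x ∘ i.succAbove) m = _ from h1, ← extend_apply]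
    by_cases hi : m < (i : ℕ)
    · rw [Fin.succAbove_of_castSucc_lt _ _ (by simpa [Fin.lt_def] using hi)]
      simp [del, hi]
    · rw [Fin.succAbove_of_le_castSucc _ _ (by simpa [Fin.le_def] using hi)]
      simp [del, hi]
  · have hi : ¬m < (i : ℕ) := by omega
    rw [extend_of_le _ (by omega), del, if_neg hi, extend_of_le _ (by omega)]

theorem exists_of_mem_substitutionBall {k : ℕ} {y z : BinSeq k} (h : z ∈ substitutionBall y) :
    ∃ t, ∀ m, m ≠ t → extend z m = extend y m := by
  have hc : (Finset.univ.filter fun i => y i ≠ z i).card ≤ 1 := h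
  rw [Finset.card_le_one] at hc
  by_cases he : ∃ i, y i ≠ z i
  · obtain ⟨i, hi⟩ := he
    refine ⟨i, fun m hm => ?_⟩
    by_cases hmk : m < k
    · have : y ⟨m, hmk⟩ = z ⟨m, hmk⟩ := by
        by_contra hne
        have := hc i (by simpa using hi) ⟨m, hmk⟩ (by simpa using hne)
        exact hm (by rw [this])
      simp [extend, hmk, this]
    · rw [extend_of_le _ (by omega), extend_of_le _ (by omega)]
  · push Not at he
    exact ⟨0, fun m _ => by rw [funext he]⟩

theorem exists_of_mem_delSubBall {k : ℕ} {x : BinSeq (k + 1)} {z : BinSeq k}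
    (h : z ∈ delSubBall x) : ∃ i ≤ k, Near (extend z) (del i (extend x)) := by
  obtain ⟨y, ⟨f, hf, rfl⟩, hz⟩ := h
  obtain ⟨i, hi⟩ := exists_succAbove_of_strictMono (k := k) hf
  refine ⟨i, by omega, ?_⟩
  rw [← extend_comp_succAbove, ← hi]
  exact exists_of_mem_substitutionBall hz

theorem sum_del {X : ℕ → Bool} {i m : ℕ} (h : i ≤ m) :
    ∑ l ∈ Finset.range m, (del i X l).toInt =
      ∑ l ∈ Finset.range (m + 1), (X l).toInt - (X i).toInt ∧
    ∑ l ∈ Finset.range m, (l : ℤ) * (del i X l).toInt =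
      ∑ l ∈ Finset.range (m + 1), (l : ℤ) * (X l).toInt - i * (X i).toInt -
        ∑ l ∈ Finset.Ico (i + 1) (m + 1), (X l).toInt := by
  induction m, h using Nat.le_induction with
  | base =>
    have h0 : ∀ l ∈ Finset.range i, del i X l = X l := fun l hl => by
      simp [del, Finset.mem_range.1 hl]
    constructor
    · rw [Finset.sum_range_succ, Finset.sum_congr rfl fun l hl => by rw [h0 l hl]]; ring
    · rw [Finset.sum_range_succ, Finset.sum_congr rfl fun l hl => by rw [h0 l hl]]; simp
  | succ n hn ih =>
    have h0 : del i X n = X (n + 1) := by simp [del, Nat.not_lt.2 hn]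
    constructor
    · rw [Finset.sum_range_succ, ih.1, h0, Finset.sum_range_succ _ (n + 1)]; ring
    · rw [Finset.sum_range_succ, ih.2, h0, Finset.sum_range_succ _ (n + 1),
        Finset.sum_Ico_succ_top (show i + 1 ≤ n + 1 by omega)]
      push_cast
      ring

theorem Near.sum_sub {Z W : ℕ → Bool} (h : Near Z W) (m : ℕ) :
    ∃ t δ : ℤ, 0 ≤ t ∧ t ≤ m ∧ (δ = -1 ∨ δ = 0 ∨ δ = 1) ∧
      ∑ l ∈ Finset.range m, (Z l).toInt = ∑ l ∈ Finset.range m, (W l).toInt + δ ∧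
      ∑ l ∈ Finset.range m, (l : ℤ) * (Z l).toInt =
        ∑ l ∈ Finset.range m, (l : ℤ) * (W l).toInt + t * δ := by
  obtain ⟨t, ht⟩ := h
  by_cases htm : t < m
  · refine ⟨t, diff Z W t, by omega, by omega, ?_, ?_, ?_⟩
    · by_cases he : Z t = W t
      · simp [diff_eq_zero.2 he]
      · rcases diff_of_ne he with h | h <;> simp [h]
    · rw [← sub_eq_iff_eq_add', ← Finset.sum_sub_distrib]
      exact Finset.sum_eq_single_of_mem t (Finset.mem_range.2 htm)
        fun l _ hl => by simp [ht l hl]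
    · rw [← sub_eq_iff_eq_add', ← Finset.sum_sub_distrib]
      rw [Finset.sum_eq_single_of_mem t (Finset.mem_range.2 htm)
        fun l _ hl => by simp [ht l hl], diff]
      ring
  · have h0 : ∀ l ∈ Finset.range m, Z l = W l := fun l hl =>
      ht l (by have := Finset.mem_range.1 hl; omega)
    refine ⟨0, 0, le_rfl, by omega, by simp, ?_, ?_⟩ <;>
      rw [Finset.sum_congr rfl fun l hl => by rw [h0 l hl]] <;> simp

/-- Congruent syndromes of sequences with a common neighbour are equal. -/
theorem balanced_of_modEq {X Y Z : ℕ → Bool} {k i j : ℕ} (hX : ∀ m, k + 1 ≤ m → X m = false)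
    (hY : ∀ m, k + 1 ≤ m → Y m = false) (hi : i ≤ k) (hj : j ≤ k) (h₁ : Near Z (del i X))
    (h₂ : Near Z (del j Y))
    (h0 : (4 : ℤ) ∣ ∑ l ∈ Finset.range (k + 1), (X l).toInt -
      ∑ l ∈ Finset.range (k + 1), (Y l).toInt)
    (h1 : (2 * (k + 1) : ℤ) ∣ ∑ l ∈ Finset.range (k + 1), ((l : ℤ) + 1) * (X l).toInt -
      ∑ l ∈ Finset.range (k + 1), ((l : ℤ) + 1) * (Y l).toInt) : Balanced X Y (k + 1) := by
  obtain ⟨t, δ, t0, t1, hδ, e0, e1⟩ := h₁.sum_sub k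
  obtain ⟨s, ε, s0, s1, hε, f0, f1⟩ := h₂.sum_sub k
  rw [(sum_del hi).1] at e0
  rw [(sum_del hj).1] at f0
  rw [(sum_del hi).2] at e1
  rw [(sum_del hj).2] at f1
  simp only [add_mul, one_mul, Finset.sum_add_distrib] at h1
  have tail : ∀ (X : ℕ → Bool) (i : ℕ), i ≤ k →
      0 ≤ ∑ l ∈ Finset.Ico (i + 1) (k + 1), (X l).toInt ∧
      ∑ l ∈ Finset.Ico (i + 1) (k + 1), (X l).toInt ≤ k - i := fun X i hi => by
    refine ⟨Finset.sum_nonneg fun l _ => toInt_nonneg _, ?_⟩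
    refine (Finset.sum_le_sum fun l _ => toInt_le_one (X l)).trans ?_
    simp only [Finset.sum_const, Nat.card_Ico, nsmul_eq_mul, mul_one]
    omega
  obtain ⟨u0, u1⟩ := tail X i hi
  obtain ⟨v0, v1⟩ := tail Y j hj
  have hi' : (i : ℤ) ≤ k := by omega
  have hj' : (j : ℤ) ≤ k := by omega
  have xi : (X i).toInt = 0 ∨ (X i).toInt = 1 := by cases X i <;> simp
  have yj : (Y j).toInt = 0 ∨ (Y j).toInt = 1 := by cases Y j <;> simp
  generalize ∑ l ∈ Finset.Ico (i + 1) (k + 1), (X l).toInt = TX at *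
  generalize ∑ l ∈ Finset.Ico (j + 1) (k + 1), (Y l).toInt = TY at *
  have hw : ∑ l ∈ Finset.range (k + 1), (X l).toInt =
      ∑ l ∈ Finset.range (k + 1), (Y l).toInt := by omega
  have hv : ∑ l ∈ Finset.range (k + 1), (l : ℤ) * (X l).toInt =
      ∑ l ∈ Finset.range (k + 1), (l : ℤ) * (Y l).toInt := by
    rw [hw, add_sub_add_right_eq_sub] at h1
    rw [hw] at e0
    generalize ∑ l ∈ Finset.range (k + 1), (l : ℤ) * (X l).toInt = VX at *
    generalize ∑ l ∈ Finset.range (k + 1), (l : ℤ) * (Y l).toInt = VY at *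
    have hlt : |VX - VY| < 2 * (k + 1) := by
      rw [abs_lt]
      rcases xi with xi | xi <;> rcases yj with yj | yj <;> rw [xi] at e0 e1 <;>
        rw [yj] at f0 f1 <;> rcases hδ with rfl | rfl | rfl <;> rcases hε with rfl | rfl | rfl <;>
        first | (exfalso; omega) | (constructor <;> linarith)
    exact sub_eq_zero.1 (Int.eq_zero_of_abs_lt_dvd h1 hlt)
  refine ⟨fun m hm => by rw [hX m hm, hY m hm], ?_, ?_⟩
  · simp only [diff, Finset.sum_sub_distrib, hw, sub_self]
  · simp only [diff, mul_sub, Finset.sum_sub_distrib, hv, sub_self]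

theorem sum_extend {n : ℕ} (x : BinSeq n) (c : ℕ → ℤ) :
    ∑ l ∈ Finset.range n, c l * (extend x l).toInt = ∑ i : Fin n, c i * ((x i : ℕ) : ℤ) := by
  rw [← Fin.sum_univ_eq_sum_range (fun l => c l * (extend x l).toInt)]
  simp only [toInt_extend]

theorem vtSyndrome_zero_eq {n : ℕ} (x : BinSeq n) :
    (vtSyndrome 0 x : ℤ) = ∑ l ∈ Finset.range n, (extend x l).toInt := by
  have := sum_extend x fun _ => 1
  simp only [one_mul] at this
  rw [this]
  simp [vtSyndrome, weight]

theorem vtSyndrome_one_eq {n : ℕ} (x : BinSeq n) :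
    (vtSyndrome 1 x : ℤ) = ∑ l ∈ Finset.range n, ((l : ℤ) + 1) * (extend x l).toInt := by
  rw [sum_extend x fun l => (l : ℤ) + 1]
  simp [vtSyndrome]

theorem codeC1_isReconstructionCode (k s₀ s₁ : ℕ) :
    IsReconstructionCode 14 (codeC1 (k + 1) s₀ s₁) := by
  classical
  intro x hx y hy hxy
  have h0 := Nat.modEq_iff_dvd.1 (hy.1.trans hx.1.symm)
  have h1 := Nat.modEq_iff_dvd.1 (hy.2.trans hx.2.symm)
  rw [vtSyndrome_zero_eq, vtSyndrome_zero_eq] at h0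
  rw [vtSyndrome_one_eq, vtSyndrome_one_eq] at h1
  push_cast at h0 h1
  rcases Set.eq_empty_or_nonempty (delSubBall x ∩ delSubBall y) with he | ⟨z₀, hz₀⟩
  · rw [he]; simp
  obtain ⟨i, hi, hi'⟩ := exists_of_mem_delSubBall hz₀.1
  obtain ⟨j, hj, hj'⟩ := exists_of_mem_delSubBall hz₀.2
  have bal := balanced_of_modEq (fun m => extend_of_le x) (fun m => extend_of_le y) hi hj hi' hj'
    h0 h1
  obtain ⟨l, hl, hl'⟩ := bal.exists_list (extend_injective.ne hxy)
  have hsub : extend '' (delSubBall x ∩ delSubBall y) ⊆ (l.toFinset : Set (ℕ → Bool)) := by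
    rintro _ ⟨z, ⟨hzx, hzy⟩, rfl⟩
    obtain ⟨i, -, hi⟩ := exists_of_mem_delSubBall hzx
    obtain ⟨j, -, hj⟩ := exists_of_mem_delSubBall hzy
    rw [List.coe_toFinset]
    apply hl'
    rcases le_total i j with hij | hij
    · exact Or.inl ⟨i, j, hij, hi, hj⟩
    · exact Or.inr ⟨j, i, hij, hj, hi⟩
  have hcard := Set.ncard_le_ncard hsub (Finset.finite_toSet _)
  rw [Set.ncard_image_of_injective _ extend_injective, Set.ncard_coe_finset] at hcard
  have := l.toFinset_card_le
  omega

theorem exists_codeC1_large (n : ℕ) (hn : 1 ≤ n) :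
    ∃ s₀ ∈ Finset.Icc 0 3, ∃ s₁ ∈ Finset.Icc 0 (2 * n - 1),
      (2 : ℝ) ^ n / (8 * n) ≤ ((codeC1 n s₀ s₁).ncard : ℝ) := by
  classical
  have hn' : (0 : ℝ) < n := by exact_mod_cast hn
  obtain ⟨⟨s₀, s₁⟩, hs, hcard⟩ := Finset.exists_le_card_fiber_of_nsmul_le_card_of_maps_to
    (s := (Finset.univ : Finset (BinSeq n)))
    (t := Finset.range 4 ×ˢ Finset.range (2 * n))
    (f := fun x => (vtSyndrome 0 x % 4, vtSyndrome 1 x % (2 * n))) (b := (2 : ℝ) ^ n / (8 * n))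
    (fun x _ => by
      simp only [Finset.mem_product, Finset.mem_range]
      exact ⟨Nat.mod_lt _ (by norm_num), Nat.mod_lt _ (by omega)⟩)
    ⟨(0, 0), by simp; omega⟩
    (by
      simp only [Finset.card_product, Finset.card_range, Finset.card_univ, Fintype.card_fun,
        Fintype.card_fin, nsmul_eq_mul]
      push_cast
      apply le_of_eq
      field_simp
      ring)
  simp only [Finset.mem_product, Finset.mem_range] at hs
  refine ⟨s₀, Finset.mem_Icc.2 (by omega), s₁, Finset.mem_Icc.2 (by omega), hcard.trans ?_⟩
  rw [← Set.ncard_coe_finset]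
  refine Nat.cast_le.2 (Set.ncard_le_ncard ?_ (Set.toFinite _))
  intro x hx
  simp only [Finset.coe_filter, Finset.mem_univ, true_and, Set.mem_ofPred_eq, Prod.mk.injEq] at hx
  refine ⟨?_, ?_⟩
  · rw [Nat.ModEq, hx.1, Nat.mod_eq_of_lt hs.1]
  · rw [Nat.ModEq, hx.2, Nat.mod_eq_of_lt hs.2]

theorem redundancy_le {n : ℕ} (hn : 1 ≤ n) {C : Set (BinSeq n)}
    (h : (2 : ℝ) ^ n / (8 * n) ≤ (C.ncard : ℝ)) : redundancy C ≤ Real.logb 2 (n : ℝ) + 3 := by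
  have hn' : (0 : ℝ) < n := by exact_mod_cast hn
  have hle := Real.logb_le_logb_of_le (b := 2) (by norm_num) (by positivity) h
  rw [Real.logb_div (by positivity) (by positivity), Real.logb_mul (by norm_num) hn'.ne',
    Real.logb_pow, Real.logb_self_eq_one (by norm_num),
    show (8 : ℝ) = 2 ^ 3 by norm_num, Real.logb_pow, Real.logb_self_eq_one (by norm_num)] at hle
  rw [redundancy]
  push_cast at hle
  linarith

end DelSub

theorem theorem5 (n : ℕ) (hn : 1 ≤ n) :
    (∀ s₀ ∈ Finset.Icc 0 3, ∀ s₁ ∈ Finset.Icc 0 (2 * n - 1),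
      DelSub.IsReconstructionCode 14 (DelSub.codeC1 n s₀ s₁)) ∧
    ∃ s₀ ∈ Finset.Icc 0 3, ∃ s₁ ∈ Finset.Icc 0 (2 * n - 1),
      (DelSub.codeC1 n s₀ s₁).Nonempty ∧
      DelSub.redundancy (DelSub.codeC1 n s₀ s₁) ≤ Real.logb 2 (n : ℝ) + 3 := by
  constructor
  · intro s₀ _ s₁ _
    obtain ⟨k, rfl⟩ := Nat.exists_eq_add_of_le' hn
    exact DelSub.codeC1_isReconstructionCode k s₀ s₁
  · obtain ⟨s₀, h₀, s₁, h₁, h⟩ := DelSub.exists_codeC1_large n hn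
    refine ⟨s₀, h₀, s₁, h₁, ?_, DelSub.redundancy_le hn h⟩
    have hn' : (0 : ℝ) < n := by exact_mod_cast hn
    have hpos : (0 : ℝ) < ((DelSub.codeC1 n s₀ s₁).ncard : ℝ) := lt_of_lt_of_le (by positivity) h
    exact Set.nonempty_of_ncard_ne_zero (by exact_mod_cast hpos.ne')
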